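/- Let $E$ be an infinite-dimensional real Banach space with an unconditional Schauder basis $(e_n)_{n\in\mathbb N}$. Suppose that $E$ has an equivalent norm $N$ that is of class $C^1$ on $E\setminus\{0\}$ and locally depends on finitely many coordinates. The latter means that for every $x\in E\setminus\{0\}$ there are an open neighbourhood $V$ of $x$, a number $l\in\mathbb N$, functionals $L_1,\dots,L_l\in E^*$ and a function $\gamma:\mathbb R^l\to\mathbb R$ such that $N(y)=\gamma(L_1(y),\dots,L_l(y))$ for every $y\in V$. Then for every open set $U\subseteq E$ there exists a $C^1$ function $\lambda:E\to[0,\infty)$ whose support $\overline{\{x\in E:\lambda(x)\neq 0\}}$ is the closure $\overline U$ and which has no critical point in $U$, that is, the derivative $D\lambda(x):E\to\mathbb R$ is surjective for every $x\in U$. In particular, the space $c_0$ of real null sequences with the supremum norm satisfies these hypotheses, and so the conclusion holds for $E=c_0$. -/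

import Mathlib

open scoped ZeroAtInfty

/-- The seminorm `N` is a norm equivalent to the given norm of `E`. -/
def IsEquivalentNorm {E : Type*} [NormedAddCommGroup E] [NormedSpace ℝ E]
    (N : Seminorm ℝ E) : Prop :=
  ∃ c C : ℝ, 0 < c ∧ 0 < C ∧ ∀ x : E, c * ‖x‖ ≤ N x ∧ N x ≤ C * ‖x‖

/-- A norm is of class `C^1` if it is a `C^1` function away from the origin. -/
def IsC1Norm {E : Type*} [NormedAddCommGroup E] [NormedSpace ℝ E]
    (N : Seminorm ℝ E) : Prop :=
  ContDiffOn ℝ 1 (fun x : E => N x) {0}ᶜ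

/-- `N` locally depends on finitely many coordinates: near every nonzero point `x` it factors
through finitely many continuous linear functionals. (The origin has to be left out: near it, no
norm on an infinite-dimensional space factors in this way.) -/
def LocallyDependsOnFinitelyManyCoordinates {E : Type*} [NormedAddCommGroup E] [NormedSpace ℝ E]
    (N : Seminorm ℝ E) : Prop :=
  ∀ x : E, x ≠ 0 → ∃ (l : ℕ) (V : Set E) (L : Fin l → StrongDual ℝ E) (γ : (Fin l → ℝ) → ℝ),
    IsOpen V ∧ x ∈ V ∧ ∀ y ∈ V, N y = γ (fun i => L i y)

/-- `E` is infinite-dimensional, has an unconditional (Schauder) basis, and has a `C^1` equivalent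
norm that locally depends on finitely many coordinates. -/
structure HasC1FiniteCoordinateNorm (E : Type*) [NormedAddCommGroup E] [NormedSpace ℝ E] :
    Prop where
  infinite_dimensional : ¬ FiniteDimensional ℝ E
  unconditional_basis : Nonempty (UnconditionalSchauderBasis ℕ ℝ E)
  exists_norm : ∃ N : Seminorm ℝ E,
    IsEquivalentNorm N ∧ IsC1Norm N ∧ LocallyDependsOnFinitelyManyCoordinates N

/-! A Schauder basis makes `E` separable, so countably many of the open sets on which `N` factors
cover `E ∖ {0}`, and all derivatives of `N` lie in a countably generated subspace `W` of `E*`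
(`exists_countable_fderiv_mem_span`). By Baire, the infinite-dimensional Banach space `E*` has
infinite dimension modulo `W`, so there are functionals `f n` independent modulo `W`. Cutoffs built
from `N` have derivatives in `W`; a locally finite family `ψ n` of them has no common zero in `U`.
Put `λ = ∑ c n * ψ n * (K n + f n)`, with `K n` making the last factor positive where `ψ n ≠ 0` and
`c n > 0` so small that the series is `C^1` on all of `E`, the boundary of `U` included. At `y ∈ U`,
the derivative is an element of `W` plus the finite sum `∑ (c n * ψ n y) • f n`, which has a nonzero
coefficient; independence modulo `W` forbids cancellation.

For `c₀`, take the gauge of `{∑ (|x n| - 1)₊² ≤ 1}`. The norm of `x ≠ 0` is the root `s > 0` of `∑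
(|x n| - s)₊² = s²`. Near a nonzero point only finitely many coordinates enter this equation
(`exists_excessNorm_eq_iff`), and the implicit function theorem gives smoothness. -/

open Set Filter Topology

/-! ### Countably generated subspaces and Baire category -/

/-- A Banach space spanned by a countable set is finite-dimensional. -/
theorem finiteDimensional_of_span_countable_eq_top {X : Type*} [NormedAddCommGroup X]
    [NormedSpace ℝ X] [CompleteSpace X] {S : Set X} (hS : S.Countable)
    (hspan : Submodule.span ℝ S = ⊤) : FiniteDimensional ℝ X := by
  rcases S.eq_empty_or_nonempty with rfl | hne
  · exact ⟨hspan ▸ Submodule.fg_span finite_empty⟩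
  obtain ⟨s, rfl⟩ := hS.exists_eq_range hne
  let F : ℕ → Submodule ℝ X := fun n => Submodule.span ℝ (s '' Iio n)
  have hfin : ∀ n, FiniteDimensional ℝ (F n) := fun n =>
    FiniteDimensional.span_of_finite ℝ ((Set.finite_Iio n).image s)
  have hmono : Monotone F := fun m n h => Submodule.span_mono (image_mono (Iio_subset_Iio h))
  have hcover : ⋃ n, (F n : Set X) = univ := by
    rw [← Submodule.coe_iSup_of_directed F hmono.directed_le, eq_univ_iff_forall]
    suffices h : (⊤ : Submodule ℝ X) ≤ ⨆ n, F n from fun x => h trivial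
    rw [← hspan, Submodule.span_le]
    rintro _ ⟨n, rfl⟩
    exact Submodule.mem_iSup_of_mem (n + 1)
      (Submodule.subset_span (mem_image_of_mem s (mem_Iio.2 n.lt_succ_self)))
  obtain ⟨n, hn⟩ := nonempty_interior_of_iUnion_of_closed
    (fun n => (F n).closed_of_finiteDimensional) hcover
  have htop := Submodule.eq_top_of_nonempty_interior' (F n) hn
  exact ⟨htop ▸ Submodule.fg_span ((Set.finite_Iio n).image s)⟩

/-- Modulo a countably generated subspace, an infinite-dimensional Banach space contains a linearly
independent sequence. -/
theorem exists_linearIndependent_mkQ_span_countable {X : Type*} [NormedAddCommGroup X]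
    [NormedSpace ℝ X] [CompleteSpace X] (hX : ¬ FiniteDimensional ℝ X) {S : Set X}
    (hS : S.Countable) :
    ∃ f : ℕ → X, LinearIndependent ℝ fun n => (Submodule.span ℝ S).mkQ (f n) := by
  set W := Submodule.span ℝ S with hW
  have hinf : ¬ FiniteDimensional ℝ (X ⧸ W) := by
    intro hfd
    obtain ⟨T, hT⟩ := hfd.fg_top
    choose g hg using W.mkQ_surjective
    -- Lifts of a finite generating set of the quotient, together with `S`, would be a countable
    -- spanning set.
    refine hX (finiteDimensional_of_span_countable_eq_top
      (hS.union ((T.finite_toSet.image g).countable)) ?_)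
    rw [Submodule.span_union, eq_top_iff, ← hW]
    have hmap : (Submodule.span ℝ (g '' T)).map W.mkQ = ⊤ := by
      rw [Submodule.map_span, image_image]
      simpa [hg] using hT
    have := congrArg (Submodule.comap W.mkQ) hmap
    rw [Submodule.comap_map_mkQ, Submodule.comap_top] at this
    exact this.ge
  let b := Module.Basis.ofVectorSpace ℝ (X ⧸ W)
  have : Infinite (Module.Basis.ofVectorSpaceIndex ℝ (X ⧸ W)) := by
    by_contra h
    rw [not_infinite_iff_finite] at h
    exact hinf (Module.Finite.of_basis b)
  choose g hg using W.mkQ_surjective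
  refine ⟨fun n => g (b (Infinite.natEmbedding _ n)), ?_⟩
  simp only [hg]
  exact b.linearIndependent.comp _ (Infinite.natEmbedding _).injective

/-! ### Derivatives of norms depending locally on finitely many coordinates -/

section SeparableSpaces

variable {E : Type*} [NormedAddCommGroup E] [NormedSpace ℝ E]

/-- A normed space with finite-dimensional dual is finite-dimensional. -/
theorem finiteDimensional_of_strongDual (h : FiniteDimensional ℝ (StrongDual ℝ E)) :
    FiniteDimensional ℝ E := by
  let T : E →ₗ[ℝ] Module.Dual ℝ (StrongDual ℝ E) :=
    (ContinuousLinearMap.coeLM ℝ) ∘ₗ (NormedSpace.inclusionInDoubleDual ℝ E).toLinearMap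
  refine FiniteDimensional.of_injective T ((injective_iff_map_eq_zero T).2 fun x hx => ?_)
  exact SeparatingDual.eq_zero_of_forall_dual_eq_zero (R := ℝ) fun f => LinearMap.congr_fun hx f

/-- A normed space with a countable unconditional Schauder basis is separable. -/
theorem separableSpace_of_unconditionalSchauderBasis (b : UnconditionalSchauderBasis ℕ ℝ E) :
    TopologicalSpace.SeparableSpace E := by
  have h := ((countable_range b.basis).isSeparable.span (R := ℝ)).closure
  rw [← TopologicalSpace.isSeparable_univ_iff]
  refine h.mono fun x _ => mem_closure_of_tendsto (b.tendsto_proj x) (Eventually.of_forall ?_)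
  intro A
  rw [b.proj_apply]
  exact Submodule.sum_mem _ fun i _ => Submodule.smul_mem _ _ (Submodule.subset_span ⟨i, rfl⟩)

/-- If a function factors near `x` through finitely many functionals, its derivative at `x` is in
their span. -/
theorem fderiv_mem_span_of_eventuallyEq_comp {ι : Type*} [Finite ι] {g : E → ℝ} {x : E}
    (hg : DifferentiableAt ℝ g x) (L : ι → StrongDual ℝ E) (γ : (ι → ℝ) → ℝ)
    (h : ∀ᶠ y in 𝓝 x, g y = γ fun i => L i y) :
    fderiv ℝ g x ∈ Submodule.span ℝ (range L) := by
  have key : (fderiv ℝ g x).toLinearMap ∈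
      Submodule.span ℝ (range fun i => (L i).toLinearMap) := by
    -- It suffices to kill the common kernel of the `L i`. For `v` in it, `g` is constant along `x +
    -- t • v` for small `t`; no regularity of `γ` is needed.
    refine mem_span_of_iInf_ker_le_ker fun v hv => ?_
    rw [Submodule.mem_iInf] at hv
    have hv' : ∀ i, L i v = 0 := hv
    have hline : HasDerivAt (fun t : ℝ => x + t • v) v 0 := by
      simpa using ((hasDerivAt_id (0 : ℝ)).smul_const v).const_add x
    have h0 : x + (0 : ℝ) • v = x := by simp
    have hd : HasDerivAt (fun t : ℝ => g (x + t • v)) (fderiv ℝ g x v) 0 := by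
      refine HasFDerivAt.comp_hasDerivAt (0 : ℝ) (l := g) ?_ hline
      rw [h0]
      exact hg.hasFDerivAt
    have hc : (fun t : ℝ => g (x + t • v)) =ᶠ[𝓝 0] fun _ => g x := by
      have htend : Tendsto (fun t : ℝ => x + t • v) (𝓝 0) (𝓝 x) := by
        simpa using hline.continuousAt.tendsto
      filter_upwards [htend.eventually h] with t ht
      rw [ht, h.self_of_nhds]
      simp [hv']
    exact hd.unique ((hasDerivAt_const (0 : ℝ) (g x)).congr_of_eventuallyEq hc)
  have := Fintype.ofFinite ι
  obtain ⟨c, hc⟩ := (Submodule.mem_span_range_iff_exists_fun ℝ).1 key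
  refine (Submodule.mem_span_range_iff_exists_fun ℝ).2 ⟨c, ?_⟩
  ext v
  simpa using LinearMap.congr_fun hc v

/-- The derivatives of a `C^1` norm that locally depends on finitely many coordinates lie in a
countably generated subspace of the dual. -/
theorem exists_countable_fderiv_mem_span [TopologicalSpace.SeparableSpace E] {N : Seminorm ℝ E}
    (hN : IsC1Norm N) (hfin : LocallyDependsOnFinitelyManyCoordinates N) :
    ∃ S : Set (StrongDual ℝ E), S.Countable ∧
      ∀ x, x ≠ 0 → fderiv ℝ (fun y => N y) x ∈ Submodule.span ℝ S := by
  have := UniformSpace.secondCountable_of_separable E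
  choose! l V L γ hV hxV hγ using hfin
  obtain ⟨T, hT0, hTc, hcover⟩ := TopologicalSpace.countable_cover_nhdsWithin (f := V)
    (s := {0}ᶜ) fun x hx => mem_nhdsWithin_of_mem_nhds ((hV x hx).mem_nhds (hxV x hx))
  refine ⟨⋃ x ∈ T, range (L x), hTc.biUnion fun x _ => countable_range _, fun x hx => ?_⟩
  obtain ⟨z, hz, hxz⟩ := mem_iUnion₂.1 (hcover hx)
  have hdiff : DifferentiableAt ℝ (fun y => N y) x :=
    (hN.contDiffAt (isOpen_compl_singleton.mem_nhds hx)).differentiableAt one_ne_zero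
  refine Submodule.span_mono (subset_biUnion_of_mem hz)
    (fderiv_mem_span_of_eventuallyEq_comp hdiff (L z) (γ z) ?_)
  filter_upwards [(hV z (hT0 hz)).mem_nhds hxz] with y hy using hγ z (hT0 hz) y hy

/-! ### Cutoff functions with derivatives in a given subspace -/

/-- A `C^1` function with values in `[0, 1]` whose derivative is bounded and takes its values in
the subspace `W` of the dual. -/
structure IsC1Cutoff (W : Submodule ℝ (StrongDual ℝ E)) (g : E → ℝ) : Prop where
  contDiff : ContDiff ℝ 1 g
  nonneg : ∀ x, 0 ≤ g x
  le_one : ∀ x, g x ≤ 1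
  fderiv_mem : ∀ x, fderiv ℝ g x ∈ W
  fderiv_bound : ∃ M : ℝ, ∀ x, ‖fderiv ℝ g x‖ ≤ M

namespace IsC1Cutoff

variable {W : Submodule ℝ (StrongDual ℝ E)} {g h : E → ℝ}

theorem differentiable (hg : IsC1Cutoff W g) : Differentiable ℝ g :=
  hg.contDiff.differentiable one_ne_zero

/-- A zero of a nonnegative function is a minimum. This later bounds the derivative of a cutoff
times an unbounded affine function: off the support both terms of the product rule vanish. -/
theorem fderiv_eq_zero (hg : IsC1Cutoff W g) {x : E} (hx : g x = 0) : fderiv ℝ g x = 0 :=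
  IsLocalMin.fderiv_eq_zero (Eventually.of_forall fun y => hx ▸ hg.nonneg y)

theorem one : IsC1Cutoff W fun _ => 1 where
  contDiff := contDiff_const
  nonneg _ := zero_le_one
  le_one _ := le_rfl
  fderiv_mem x := by simp
  fderiv_bound := ⟨0, by simp⟩

theorem one_sub (hg : IsC1Cutoff W g) : IsC1Cutoff W fun x => 1 - g x where
  contDiff := contDiff_const.sub hg.contDiff
  nonneg x := sub_nonneg.2 (hg.le_one x)
  le_one x := sub_le_self _ (hg.nonneg x)
  fderiv_mem x := by
    rw [fderiv_const_sub]
    exact W.neg_mem (hg.fderiv_mem x)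
  fderiv_bound := by
    obtain ⟨M, hM⟩ := hg.fderiv_bound
    exact ⟨M, fun x => by rw [fderiv_const_sub, norm_neg]; exact hM x⟩

theorem mul (hg : IsC1Cutoff W g) (hh : IsC1Cutoff W h) : IsC1Cutoff W fun x => g x * h x := by
  have hd : ∀ x, fderiv ℝ (fun x => g x * h x) x = g x • fderiv ℝ h x + h x • fderiv ℝ g x :=
    fun x => fderiv_fun_mul (hg.differentiable x) (hh.differentiable x)
  refine ⟨hg.contDiff.mul hh.contDiff, fun x => mul_nonneg (hg.nonneg x) (hh.nonneg x),
    fun x => mul_le_one₀ (hg.le_one x) (hh.nonneg x) (hh.le_one x), fun x => ?_, ?_⟩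
  · rw [hd]
    exact W.add_mem (W.smul_mem _ (hh.fderiv_mem x)) (W.smul_mem _ (hg.fderiv_mem x))
  · obtain ⟨M, hM⟩ := hg.fderiv_bound
    obtain ⟨K, hK⟩ := hh.fderiv_bound
    refine ⟨K + M, fun x => ?_⟩
    rw [hd]
    refine (norm_add_le _ _).trans (add_le_add ?_ ?_)
    · rw [norm_smul, Real.norm_of_nonneg (hg.nonneg x)]
      exact (mul_le_of_le_one_left (norm_nonneg _) (hg.le_one x)).trans (hK x)
    · rw [norm_smul, Real.norm_of_nonneg (hh.nonneg x)]
      exact (mul_le_of_le_one_left (norm_nonneg _) (hh.le_one x)).trans (hM x)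

theorem prod_range {b : ℕ → E → ℝ} (hb : ∀ n, IsC1Cutoff W (b n)) (n : ℕ) :
    IsC1Cutoff W fun x => ∏ j ∈ Finset.range n, b j x := by
  induction n with
  | zero => simpa using one
  | succ n ih => simpa only [Finset.prod_range_succ] using ih.mul (hb n)

end IsC1Cutoff

/-- The derivative of `Real.smoothTransition` is bounded. -/
theorem exists_abs_deriv_smoothTransition_le :
    ∃ M : ℝ, 0 ≤ M ∧ ∀ t, |deriv Real.smoothTransition t| ≤ M := by
  have hcd : ContDiff ℝ 1 Real.smoothTransition := Real.smoothTransition.contDiff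
  obtain ⟨M, hM⟩ := (isCompact_Icc (a := (0 : ℝ)) (b := 1)).exists_bound_of_continuousOn
    (hcd.continuous_deriv le_rfl).continuousOn
  refine ⟨M, (norm_nonneg _).trans (hM 0 (by simp)), fun t => ?_⟩
  by_cases ht : t ∈ Icc (0 : ℝ) 1
  · exact hM t ht
  · have hM0 : 0 ≤ M := (norm_nonneg _).trans (hM 0 (by simp))
    suffices h : deriv Real.smoothTransition t = 0 by simpa [h] using hM0
    rw [mem_Icc, not_and_or, not_le, not_le] at ht
    rcases ht with ht | ht
    · have : Real.smoothTransition =ᶠ[𝓝 t] fun _ => 0 := by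
        filter_upwards [Iio_mem_nhds ht] with s hs
        exact Real.smoothTransition.zero_of_nonpos (mem_Iio.1 hs).le
      rw [this.deriv_eq, deriv_const]
    · have : Real.smoothTransition =ᶠ[𝓝 t] fun _ => 1 := by
        filter_upwards [Ioi_mem_nhds ht] with s hs
        exact Real.smoothTransition.one_of_one_le (mem_Ioi.1 hs).le
      rw [this.deriv_eq, deriv_const]

/-- The derivative of an equivalent norm is bounded. -/
theorem norm_fderiv_seminorm_le {N : Seminorm ℝ E} {C : ℝ} (hC : 0 ≤ C)
    (hN : ∀ x, N x ≤ C * ‖x‖) (x : E) : ‖fderiv ℝ (fun y => N y) x‖ ≤ C := by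
  have hL : LipschitzWith C.toNNReal (fun y => N y) := by
    refine LipschitzWith.of_dist_le_mul fun x y => ?_
    rw [Real.dist_eq, Real.coe_toNNReal C hC, dist_eq_norm]
    exact (abs_sub_map_le_sub N x y).trans (hN _)
  simpa [Real.coe_toNNReal C hC] using norm_fderiv_le_of_lipschitz ℝ hL (x₀ := x)

/-- Cutoff functions around a point of an open set. -/
theorem exists_isC1Cutoff {N : Seminorm ℝ E} (hequiv : IsEquivalentNorm N) (hC1 : IsC1Norm N)
    {W : Submodule ℝ (StrongDual ℝ E)} (hW : ∀ x, x ≠ 0 → fderiv ℝ (fun y => N y) x ∈ W)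
    {U : Set E} (hU : IsOpen U) {a : E} (ha : a ∈ U) :
    ∃ b : E → ℝ, IsC1Cutoff W b ∧ (∀ᶠ y in 𝓝 a, b y = 1) ∧ (∀ y, y ∉ U → b y = 0) ∧
      ∃ R : ℝ, ∀ y, b y ≠ 0 → ‖y‖ ≤ R := by
  obtain ⟨c, C, hc, hC, hN⟩ := hequiv
  obtain ⟨ρ, hρ, hball⟩ := Metric.isOpen_iff.1 hU a ha
  obtain ⟨M, hM0, hM⟩ := exists_abs_deriv_smoothTransition_le
  set r := c * ρ with hr
  have hr0 : 0 < r := mul_pos hc hρ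
  -- `q ≥ 1` where `N (y - a) ≤ r / 2`, and `q ≤ 0` where `N (y - a) ≥ r`, in particular outside the
  -- ball of radius `ρ`. So `b` is constant near `a`, where `N (y - a)` may fail to be
  -- differentiable.
  let q : E → ℝ := fun y => 2 - 2 / r * N (y - a)
  let b : E → ℝ := fun y => Real.smoothTransition (q y)
  have hNcont : Continuous fun y => N (y - a) := by
    have : Continuous N := Seminorm.continuous_of_le (q := C.toNNReal • normSeminorm ℝ E)
      (continuous_const.mul continuous_norm) fun x => by
        simpa [NNReal.smul_def, Real.coe_toNNReal C hC.le] using (hN x).2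
    exact this.comp (continuous_id.sub continuous_const)
  have hone : ∀ᶠ y in 𝓝 a, b y = 1 := by
    have : ∀ᶠ y in 𝓝 a, N (y - a) < r / 2 :=
      hNcont.continuousAt.eventually_lt continuousAt_const (by simpa using half_pos hr0)
    filter_upwards [this] with y hy
    refine Real.smoothTransition.one_of_one_le ?_
    have : 2 / r * N (y - a) ≤ 2 / r * (r / 2) := by gcongr
    have h2 : 2 / r * (r / 2) = 1 := by field_simp
    simp only [q]; linarith
  have hnear : ∀ y, b y ≠ 0 → ‖y - a‖ < ρ := by
    intro y hy
    by_contra! h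
    refine hy (Real.smoothTransition.zero_of_nonpos ?_)
    have h1 : r ≤ N (y - a) := (mul_le_mul_of_nonneg_left h hc.le).trans (hN _).1
    have : 2 / r * r ≤ 2 / r * N (y - a) := by gcongr
    have h2 : 2 / r * r = 2 := by field_simp
    simp only [q]; linarith
  have hqd : ∀ y, y ≠ a → ContDiffAt ℝ 1 q y := by
    intro y hy
    have h1 : ContDiffAt ℝ 1 (fun y => N y) (y - a) :=
      hC1.contDiffAt (isOpen_compl_singleton.mem_nhds (sub_ne_zero.2 hy))
    have h2 : ContDiffAt ℝ 1 (fun y => N (y - a)) y :=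
      h1.comp y (contDiffAt_id.sub contDiffAt_const)
    exact contDiffAt_const.sub (contDiffAt_const.mul h2)
  have hbd : ContDiff ℝ 1 b := by
    refine contDiff_iff_contDiffAt.2 fun y => ?_
    rcases eq_or_ne y a with rfl | hy
    · exact contDiffAt_const.congr_of_eventuallyEq hone
    · exact Real.smoothTransition.contDiffAt.comp y (hqd y hy)
  have hfd : ∀ y, fderiv ℝ b y = 0 ∨ (y ≠ a ∧ fderiv ℝ b y =
      (deriv Real.smoothTransition (q y) * -(2 / r)) • fderiv ℝ (fun y => N y) (y - a)) := by
    intro y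
    rcases eq_or_ne y a with rfl | hy
    · left
      have : b =ᶠ[𝓝 y] fun _ => 1 := hone
      rw [this.fderiv_eq]
      simp
    · right
      refine ⟨hy, ?_⟩
      have h1 : DifferentiableAt ℝ (fun y => N y) (y - a) :=
        (hC1.contDiffAt (isOpen_compl_singleton.mem_nhds
          (sub_ne_zero.2 hy))).differentiableAt one_ne_zero
      have h2 : HasFDerivAt (fun y => N (y - a)) (fderiv ℝ (fun y => N y) (y - a)) y := by
        have h := h1.hasFDerivAt.comp y ((hasFDerivAt_id y).sub_const a)
        rwa [ContinuousLinearMap.comp_id] at h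
      have h3 : HasFDerivAt q (-((2 / r) • fderiv ℝ (fun y => N y) (y - a))) y :=
        (h2.const_mul (2 / r)).const_sub 2
      have h4 : HasDerivAt Real.smoothTransition (deriv Real.smoothTransition (q y)) (q y) :=
        ((Real.smoothTransition.contDiffAt (n := 1)).differentiableAt one_ne_zero).hasDerivAt
      have h5 : HasFDerivAt b _ y := h4.comp_hasFDerivAt y h3
      rw [h5.fderiv, mul_smul, neg_smul]
  refine ⟨b, ⟨hbd, fun y => Real.smoothTransition.nonneg _,
    fun y => Real.smoothTransition.le_one _, fun y => ?_, M * (2 / r) * C, fun y => ?_⟩,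
    hone, fun y hy => ?_, ρ + ‖a‖, fun y hy => ?_⟩
  · rcases hfd y with h | ⟨hy, h⟩
    · simp [h]
    · rw [h]
      exact W.smul_mem _ (hW _ (sub_ne_zero.2 hy))
  · rcases hfd y with h | ⟨-, h⟩
    · rw [h, norm_zero]
      positivity
    · rw [h, norm_smul]
      refine mul_le_mul ?_ (norm_fderiv_seminorm_le hC.le (fun x => (hN x).2) _)
        (norm_nonneg _) (by positivity)
      rw [norm_mul, norm_neg, Real.norm_of_nonneg (by positivity : 0 ≤ 2 / r)]
      exact mul_le_mul_of_nonneg_right (hM _) (by positivity)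
  · by_contra h
    exact hy (hball (by simpa [dist_eq_norm] using hnear y h))
  · have := norm_add_le (y - a) a
    rw [sub_add_cancel] at this
    linarith [hnear y hy]

/-- A nonempty open set carries a countable locally finite family of cutoff functions without
common zeros. -/
theorem exists_locallyFinite_isC1Cutoff [TopologicalSpace.SeparableSpace E] {N : Seminorm ℝ E}
    (hequiv : IsEquivalentNorm N) (hC1 : IsC1Norm N) {W : Submodule ℝ (StrongDual ℝ E)}
    (hW : ∀ x, x ≠ 0 → fderiv ℝ (fun y => N y) x ∈ W) {U : Set E} (hU : IsOpen U)
    (hne : U.Nonempty) :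
    ∃ ψ : ℕ → E → ℝ, (∀ n, IsC1Cutoff W (ψ n)) ∧ (∀ n, ∃ R : ℝ, ∀ y, ψ n y ≠ 0 → ‖y‖ ≤ R) ∧
      (∀ n y, y ∉ U → ψ n y = 0) ∧ (∀ y ∈ U, ∃ n, ψ n y ≠ 0) ∧
      ∀ y ∈ U, ∃ m, ∀ᶠ z in 𝓝 y, ∀ n, m < n → ψ n z = 0 := by
  have := UniformSpace.secondCountable_of_separable E
  choose! b hb hb1 hb0 hbR using fun a (ha : a ∈ U) => exists_isC1Cutoff hequiv hC1 hW hU ha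
  obtain ⟨T, hTU, hTc, hcover⟩ := TopologicalSpace.countable_cover_nhdsWithin
    (f := fun a => interior {y | b a y = 1}) (s := U)
    fun a ha => mem_nhdsWithin_of_mem_nhds (interior_mem_nhds.2 (hb1 a ha))
  have hTne : T.Nonempty := by
    obtain ⟨x, hx⟩ := hne
    obtain ⟨a, ha, -⟩ := mem_iUnion₂.1 (hcover hx)
    exact ⟨a, ha⟩
  obtain ⟨s, rfl⟩ := hTc.exists_eq_range hTne
  have hs : ∀ n, s n ∈ U := fun n => hTU (mem_range_self n)
  have hlocal : ∀ y ∈ U, ∃ m, ∀ᶠ z in 𝓝 y, b (s m) z = 1 := by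
    intro y hy
    obtain ⟨_, ⟨m, rfl⟩, hm⟩ := mem_iUnion₂.1 (hcover hy)
    exact ⟨m, mem_interior_iff_mem_nhds.1 hm⟩
  -- The product kills `ψ n` wherever an earlier cutoff equals 1, which gives local finiteness. At
  -- the first index whose cutoff is 1 at `y`, no factor vanishes.
  refine ⟨fun n y => b (s n) y * ∏ j ∈ Finset.range n, (1 - b (s j) y), fun n => ?_, fun n => ?_,
    fun n y hy => ?_, fun y hy => ?_, fun y hy => ?_⟩
  · exact (hb _ (hs n)).mul (IsC1Cutoff.prod_range (b := fun j y => 1 - b (s j) y)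
      (fun j => (hb _ (hs j)).one_sub) n)
  · obtain ⟨R, hR⟩ := hbR _ (hs n)
    exact ⟨R, fun y hy => hR y (left_ne_zero_of_mul hy)⟩
  · simp [hb0 _ (hs n) y hy]
  · classical
    have hex : ∃ m, b (s m) y = 1 := (hlocal y hy).imp fun m hm => hm.self_of_nhds
    refine ⟨Nat.find hex, ?_⟩
    beta_reduce
    rw [Nat.find_spec hex, one_mul]
    refine Finset.prod_ne_zero_iff.2 fun j hj => sub_ne_zero.2 fun h => ?_
    exact Nat.find_min hex (Finset.mem_range.1 hj) h.symm
  · obtain ⟨m, hm⟩ := hlocal y hy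
    refine ⟨m, hm.mono fun z hz n hn => ?_⟩
    beta_reduce
    rw [Finset.prod_eq_zero (i := m) (Finset.mem_range.2 hn) (by rw [hz, sub_self]), mul_zero]

/-! ### The function without critical points -/

/-- A series of nonnegative functions with bounded `C^1` norm becomes `C^1` after rescaling. -/
theorem exists_contDiff_tsum_mul {g : ℕ → E → ℝ} (hg : ∀ n, ContDiff ℝ 1 (g n))
    (hb : ∀ n, ∃ M : ℝ, ∀ x, |g n x| ≤ M ∧ ‖fderiv ℝ (g n) x‖ ≤ M) :
    ∃ c : ℕ → ℝ, (∀ n, 0 < c n) ∧ (∀ x, Summable fun n => c n * g n x) ∧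
      ContDiff ℝ 1 fun x => ∑' n, c n * g n x := by
  choose M hM using hb
  have hM0 : ∀ n, 0 ≤ M n := fun n => (abs_nonneg _).trans (hM n 0).1
  -- The weights dominate both the values and the derivatives by a geometric series; the `+ 1` keeps
  -- the denominator positive.
  let c : ℕ → ℝ := fun n => (1 / 2) ^ n / (M n + 1)
  have hc0 : ∀ n, 0 < c n := fun n => div_pos (by positivity) (by linarith [hM0 n])
  have hcM : ∀ n, c n * M n ≤ (1 / 2) ^ n := by
    intro n
    have h1 : 0 < M n + 1 := by linarith [hM0 n]
    rw [div_mul_eq_mul_div, div_le_iff₀ h1]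
    exact mul_le_mul_of_nonneg_left (by linarith) (by positivity)
  have hbound : ∀ n x, ‖c n * g n x‖ ≤ (1 / 2) ^ n := fun n x => by
    rw [norm_mul, Real.norm_of_nonneg (hc0 n).le]
    exact (mul_le_mul_of_nonneg_left (hM n x).1 (hc0 n).le).trans (hcM n)
  have hsum : Summable fun n : ℕ => (1 / 2 : ℝ) ^ n :=
    summable_geometric_of_lt_one (by norm_num) (by norm_num)
  refine ⟨c, hc0, fun x => Summable.of_norm_bounded hsum fun n => hbound n x, ?_⟩
  refine contDiff_tsum (N := 1) (v := fun _ n => (1 / 2) ^ n)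
    (fun n => contDiff_const.mul (hg n)) (fun _ _ => hsum) fun k n x hk => ?_
  have hk' : k ≤ 1 := by exact_mod_cast hk
  interval_cases k
  · rw [norm_iteratedFDeriv_zero]
    exact hbound n x
  · rw [norm_iteratedFDeriv_one, fderiv_const_mul ((hg n).differentiable one_ne_zero x), norm_smul,
      Real.norm_of_nonneg (hc0 n).le]
    exact (mul_le_mul_of_nonneg_left (hM n x).2 (hc0 n).le).trans (hcM n)

/-- A linear combination with a nonzero coefficient of vectors that are independent modulo `W` does
not cancel an element of `W`. -/
theorem add_sum_smul_ne_zero_of_linearIndependent_mkQ {X : Type*} [AddCommGroup X] [Module ℝ X]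
    {W : Submodule ℝ X} {f : ℕ → X} (hf : LinearIndependent ℝ fun n => W.mkQ (f n))
    {s : Finset ℕ} {c : ℕ → ℝ} {w : X} (hw : w ∈ W) {n : ℕ} (hn : n ∈ s) (hcn : c n ≠ 0) :
    w + ∑ i ∈ s, c i • f i ≠ 0 := by
  intro h
  refine hcn (linearIndependent_iff'.1 hf s c ?_ n hn)
  have hw0 : W.mkQ w = 0 := (Submodule.Quotient.mk_eq_zero W).2 hw
  have := congrArg W.mkQ h
  rw [map_add, map_sum, hw0, zero_add, map_zero] at this
  simpa using this

/-- In a separable infinite-dimensional Banach space with a `C^1` equivalent norm that locally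
depends on finitely many coordinates, every open set is the open support of a nonnegative `C^1`
function without critical points there. -/
theorem exists_contDiff_support_eq_fderiv_ne_zero [CompleteSpace E]
    [TopologicalSpace.SeparableSpace E] (hE : ¬ FiniteDimensional ℝ E) {N : Seminorm ℝ E}
    (hequiv : IsEquivalentNorm N) (hC1 : IsC1Norm N)
    (hfin : LocallyDependsOnFinitelyManyCoordinates N) {U : Set E} (hU : IsOpen U) :
    ∃ lam : E → ℝ, ContDiff ℝ 1 lam ∧ (∀ x, 0 ≤ lam x) ∧ Function.support lam = U ∧
      ∀ x ∈ U, fderiv ℝ lam x ≠ 0 := by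
  rcases U.eq_empty_or_nonempty with rfl | hne
  · exact ⟨0, contDiff_const, fun _ => le_rfl, Function.support_zero, fun x hx => hx.elim⟩
  obtain ⟨S, hSc, hS⟩ := exists_countable_fderiv_mem_span hC1 hfin
  obtain ⟨f, hf⟩ := exists_linearIndependent_mkQ_span_countable
    (fun h => hE (finiteDimensional_of_strongDual h)) hSc
  set W := Submodule.span ℝ S
  obtain ⟨ψ, hψ, hψR, hψU, hψpos, hψfin⟩ :=
    exists_locallyFinite_isC1Cutoff hequiv hC1 hS hU hne
  choose R hR using hψR
  have hfR : ∀ n y, ψ n y ≠ 0 → |f n y| ≤ ‖f n‖ * |R n| := fun n y hy =>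
    ((f n).le_opNorm y).trans
      (mul_le_mul_of_nonneg_left ((hR n y hy).trans (le_abs_self _)) (norm_nonneg _))
  -- Since `|f n| ≤ ‖f n‖ * |R n|` where `ψ n ≠ 0`, the affine factor `K n + f n` is at least 1
  -- there.
  set K : ℕ → ℝ := fun n => ‖f n‖ * |R n| + 1 with hK
  have hK1 : ∀ n, 1 ≤ K n := fun n => le_add_of_nonneg_left (by positivity)
  have hKf : ∀ n y, ψ n y ≠ 0 → 0 < K n + f n y ∧ |K n + f n y| ≤ 2 * K n := fun n y hy => by
    have h := abs_le.1 (hfR n y hy)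
    have := hK1 n
    constructor
    · simp only [hK]; linarith
    · rw [abs_le]; simp only [hK] at *; constructor <;> linarith
  let g : ℕ → E → ℝ := fun n y => ψ n y * (K n + f n y)
  have hg : ∀ n, ContDiff ℝ 1 (g n) := fun n =>
    (hψ n).contDiff.mul (contDiff_const.add (f n).contDiff)
  have hg' : ∀ n y, fderiv ℝ (g n) y = ψ n y • f n + (K n + f n y) • fderiv ℝ (ψ n) y :=
    fun n y => (((hψ n).differentiable y).hasFDerivAt.mul
      ((f n).hasFDerivAt.const_add (K n))).fderiv
  have hg0 : ∀ n y, 0 ≤ g n y := fun n y => by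
    by_cases h : ψ n y = 0
    · simp [g, h]
    · exact mul_nonneg ((hψ n).nonneg y) (hKf n y h).1.le
  have hgM : ∀ n, ∃ M : ℝ, ∀ y, |g n y| ≤ M ∧ ‖fderiv ℝ (g n) y‖ ≤ M := by
    intro n
    obtain ⟨M, hM⟩ := (hψ n).fderiv_bound
    have hM0 : 0 ≤ M := (norm_nonneg _).trans (hM 0)
    have hKn : 0 ≤ 2 * K n := by linarith [hK1 n]
    refine ⟨2 * K n + ‖f n‖ + 2 * K n * M, fun y => ?_⟩
    by_cases h : ψ n y = 0
    · have h1 : g n y = 0 := by simp [g, h]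
      have h2 : fderiv ℝ (g n) y = 0 := by rw [hg', (hψ n).fderiv_eq_zero h, h]; simp
      rw [h1, h2, abs_zero, norm_zero]
      have : 0 ≤ 2 * K n + ‖f n‖ + 2 * K n * M := by positivity
      exact ⟨this, this⟩
    · have hle : |ψ n y| ≤ 1 := by rw [abs_of_nonneg ((hψ n).nonneg y)]; exact (hψ n).le_one y
      constructor
      · have h1 : |g n y| ≤ 1 * (2 * K n) := by
          rw [abs_mul]
          exact mul_le_mul hle (hKf n y h).2 (abs_nonneg _) zero_le_one
        have : 0 ≤ ‖f n‖ + 2 * K n * M := by positivity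
        linarith
      · rw [hg']
        refine (norm_add_le _ _).trans ?_
        rw [norm_smul, norm_smul, Real.norm_eq_abs, Real.norm_eq_abs]
        have h1 : |ψ n y| * ‖f n‖ ≤ 1 * ‖f n‖ := mul_le_mul_of_nonneg_right hle (norm_nonneg _)
        have h2 : |K n + f n y| * ‖fderiv ℝ (ψ n) y‖ ≤ 2 * K n * M :=
          mul_le_mul (hKf n y h).2 (hM y) (norm_nonneg _) hKn
        linarith
  obtain ⟨c, hc0, hcs, hcd⟩ := exists_contDiff_tsum_mul hg hgM
  have hterm : ∀ n y, 0 ≤ c n * g n y := fun n y => mul_nonneg (hc0 n).le (hg0 n y)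
  refine ⟨_, hcd, fun y => tsum_nonneg fun n => hterm n y, ?_, fun y hy => ?_⟩
  · ext y
    rw [Function.mem_support]
    constructor
    · contrapose!
      intro hy
      simp [g, hψU _ y hy]
    · intro hy
      obtain ⟨n, hn⟩ := hψpos y hy
      have hpos : 0 < c n * g n y := mul_pos (hc0 n) (mul_pos
        (((hψ n).nonneg y).lt_of_ne' hn) (hKf n y hn).1)
      exact ((hcs y).tsum_pos (fun n => hterm n y) n hpos).ne'
  · obtain ⟨m, hm⟩ := hψfin y hy
    obtain ⟨n, hn⟩ := hψpos y hy
    have hnm : n ∈ Finset.range (m + 1) := by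
      by_contra h
      exact hn (hm.self_of_nhds n (by simpa using h))
    -- Local finiteness makes the series a finite sum near `y`, so its derivative is a finite linear
    -- combination, as linear independence requires.
    have heq : (fun z => ∑' n, c n * g n z) =ᶠ[𝓝 y]
        fun z => ∑ n ∈ Finset.range (m + 1), c n * g n z := by
      filter_upwards [hm] with z hz
      refine tsum_eq_sum fun k hk => ?_
      simp [g, hz k (by simpa using hk)]
    have hder : fderiv ℝ (fun z => ∑ n ∈ Finset.range (m + 1), c n * g n z) y =
        ∑ n ∈ Finset.range (m + 1), (c n * (K n + f n y)) • fderiv ℝ (ψ n) y +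
          ∑ n ∈ Finset.range (m + 1), (c n * ψ n y) • f n := by
      have hd : ∀ n, DifferentiableAt ℝ (g n) y := fun n => (hg n).differentiable one_ne_zero y
      rw [fderiv_fun_sum fun n _ => (hd n).const_mul (c n), ← Finset.sum_add_distrib]
      refine Finset.sum_congr rfl fun n _ => ?_
      rw [fderiv_const_mul (hd n), hg', smul_add, smul_smul, smul_smul, add_comm]
    rw [heq.fderiv_eq, hder]
    exact add_sum_smul_ne_zero_of_linearIndependent_mkQ hf
      (W.sum_mem fun i _ => W.smul_mem _ ((hψ i).fderiv_mem y)) hnm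
      (mul_ne_zero (hc0 n).ne' hn)

/-- In a space satisfying `HasC1FiniteCoordinateNorm`, the closure of every open set `U` is the support
of a nonnegative `C^1` function without critical points in `U`. -/
theorem HasC1FiniteCoordinateNorm.exists_contDiff_tsupport_eq [CompleteSpace E]
    (h : HasC1FiniteCoordinateNorm E) {U : Set E} (hU : IsOpen U) :
    ∃ lam : E → ℝ, ContDiff ℝ 1 lam ∧ (∀ x, 0 ≤ lam x) ∧ tsupport lam = closure U ∧
      ∀ x ∈ U, Function.Surjective (fderiv ℝ lam x) := by
  obtain ⟨b⟩ := h.unconditional_basis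
  obtain ⟨N, hequiv, hC1, hfin⟩ := h.exists_norm
  have := separableSpace_of_unconditionalSchauderBasis b
  obtain ⟨lam, h1, h2, h3, h4⟩ := exists_contDiff_support_eq_fderiv_ne_zero
    h.infinite_dimensional hequiv hC1 hfin hU
  refine ⟨lam, h1, h2, by rw [tsupport, h3], fun x hx => ?_⟩
  exact LinearMap.surjective (f := (fderiv ℝ lam x).toLinearMap) fun h0 =>
    h4 x hx (ContinuousLinearMap.coe_injective h0)

end SeparableSpaces

/-! ### Calculus of the squared excess -/

/-- The square of the positive part. -/
noncomputable def posSq (t : ℝ) : ℝ := max t 0 ^ 2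

theorem posSq_nonneg (t : ℝ) : 0 ≤ posSq t := sq_nonneg _

theorem posSq_of_nonpos {t : ℝ} (ht : t ≤ 0) : posSq t = 0 := by simp [posSq, ht]

theorem posSq_mono : Monotone posSq := fun _ _ h =>
  pow_le_pow_left₀ (le_max_right _ _) (max_le_max_right 0 h) 2

theorem posSq_mul {c : ℝ} (hc : 0 ≤ c) (t : ℝ) : posSq (c * t) = c ^ 2 * posSq t := by
  rw [posSq, posSq, ← mul_pow, mul_max_of_nonneg _ _ hc, mul_zero]

theorem convexOn_posSq : ConvexOn ℝ univ posSq := by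
  have h : ConvexOn ℝ univ fun t : ℝ => max t 0 :=
    (convexOn_id convex_univ).sup (convexOn_const 0 convex_univ)
  exact h.pow (fun _ _ => le_max_right _ _) 2

theorem hasDerivAt_posSq (t : ℝ) : HasDerivAt posSq (2 * max t 0) t := by
  rcases lt_trichotomy t 0 with ht | rfl | ht
  · rw [max_eq_right ht.le, mul_zero]
    refine (hasDerivAt_const t (0 : ℝ)).congr_of_eventuallyEq ?_
    filter_upwards [Iio_mem_nhds ht] with s hs using posSq_of_nonpos (mem_Iio.1 hs).le
  -- At the origin, `posSq s ≤ s ^ 2 = o(s)`.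
  · rw [max_self, mul_zero, hasDerivAt_iff_isLittleO]
    have h : (fun s : ℝ => posSq s) =O[𝓝 0] fun s => s ^ 2 := by
      refine Asymptotics.IsBigO.of_bound 1 (Eventually.of_forall fun s => ?_)
      rw [one_mul, norm_pow, Real.norm_of_nonneg (posSq_nonneg s), posSq, Real.norm_eq_abs]
      exact pow_le_pow_left₀ (le_max_right _ _) (max_le (le_abs_self s) (abs_nonneg s)) 2
    simpa [posSq_of_nonpos] using h.trans_isLittleO (Asymptotics.isLittleO_pow_id one_lt_two)
  · rw [max_eq_left ht.le]
    have h : HasDerivAt (fun s : ℝ => s ^ 2) (2 * t) t := by simpa using hasDerivAt_pow 2 t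
    refine h.congr_of_eventuallyEq ?_
    filter_upwards [Ioi_mem_nhds ht] with s hs
    rw [posSq, max_eq_left (mem_Ioi.1 hs).le]

theorem contDiff_posSq : ContDiff ℝ 1 posSq := by
  rw [contDiff_one_iff_deriv]
  refine ⟨fun t => (hasDerivAt_posSq t).differentiableAt, ?_⟩
  rw [funext fun t => (hasDerivAt_posSq t).deriv]
  fun_prop

/-- The function `(|a| - s)₊ ^ 2`, in a form that is `C^1` in both variables. -/
noncomputable def excessSq (a s : ℝ) : ℝ := posSq (a - s) + posSq (-a - s)

theorem excessSq_nonneg (a s : ℝ) : 0 ≤ excessSq a s :=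
  add_nonneg (posSq_nonneg _) (posSq_nonneg _)

theorem excessSq_eq_posSq_abs (a : ℝ) {s : ℝ} (hs : 0 ≤ s) :
    excessSq a s = posSq (|a| - s) := by
  rcases le_total 0 a with ha | ha
  · rw [excessSq, abs_of_nonneg ha, posSq_of_nonpos (t := -a - s) (by linarith), add_zero]
  · rw [excessSq, abs_of_nonpos ha, posSq_of_nonpos (t := a - s) (by linarith), zero_add]

theorem excessSq_eq_zero {a s : ℝ} (h : |a| ≤ s) : excessSq a s = 0 := by
  rw [excessSq_eq_posSq_abs a ((abs_nonneg a).trans h), posSq_of_nonpos (by linarith)]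

theorem excessSq_mul {c : ℝ} (hc : 0 ≤ c) (a s : ℝ) :
    excessSq (c * a) (c * s) = c ^ 2 * excessSq a s := by
  rw [excessSq, excessSq, mul_add, ← posSq_mul hc, ← posSq_mul hc]
  ring_nf

theorem excessSq_antitone (a : ℝ) : Antitone (excessSq a) := fun s t h =>
  add_le_add (posSq_mono (by linarith)) (posSq_mono (by linarith))

theorem convexOn_excessSq (s : ℝ) : ConvexOn ℝ univ fun a => excessSq a s := by
  refine ⟨convex_univ, fun x _ y _ t u ht hu htu => ?_⟩
  have h1 := convexOn_posSq.2 (mem_univ (x - s)) (mem_univ (y - s)) ht hu htu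
  have h2 := convexOn_posSq.2 (mem_univ (-x - s)) (mem_univ (-y - s)) ht hu htu
  have hs : s = t * s + u * s := by rw [← add_mul, htu, one_mul]
  simp only [smul_eq_mul, excessSq] at *
  have e1 : t * x + u * y - s = t * (x - s) + u * (y - s) := by linear_combination -hs
  have e2 : -(t * x + u * y) - s = t * (-x - s) + u * (-y - s) := by linear_combination -hs
  rw [e1, e2]
  linarith

theorem contDiff_excessSq : ContDiff ℝ 1 fun p : ℝ × ℝ => excessSq p.1 p.2 :=
  (contDiff_posSq.comp (contDiff_fst.sub contDiff_snd)).add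
    (contDiff_posSq.comp (contDiff_fst.neg.sub contDiff_snd))

/-! ### The space `c₀` and its unit vector basis -/

namespace NullSequence

theorem abs_apply_le_norm (x : C₀(ℕ, ℝ)) (n : ℕ) : |x n| ≤ ‖x‖ :=
  x.toBCF.norm_coe_le_norm n

theorem norm_le {x : C₀(ℕ, ℝ)} {C : ℝ} (hC : 0 ≤ C) (h : ∀ n, |x n| ≤ C) : ‖x‖ ≤ C :=
  (BoundedContinuousFunction.norm_le hC (f := x.toBCF)).2 h

theorem finite_le_abs (x : C₀(ℕ, ℝ)) {δ : ℝ} (hδ : 0 < δ) : {n | δ ≤ |x n|}.Finite := by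
  have h : Tendsto x cofinite (𝓝 0) := by
    rw [← cocompact_eq_cofinite]
    exact x.zero_at_infty'
  have h2 := h.eventually (Metric.ball_mem_nhds 0 hδ)
  refine (eventually_cofinite.1 h2).subset fun n hn => ?_
  simpa using hn

/-- The coordinate functionals of `c₀`. -/
noncomputable def coord (n : ℕ) : StrongDual ℝ C₀(ℕ, ℝ) :=
  LinearMap.mkContinuous { toFun := fun x => x n, map_add' := fun _ _ => rfl,
                           map_smul' := fun _ _ => rfl } 1
    fun x => by simpa using abs_apply_le_norm x n

@[simp]
theorem coord_apply (n : ℕ) (x : C₀(ℕ, ℝ)) : coord n x = x n := rfl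

/-- The unit vectors of `c₀`. -/
noncomputable def unitVec (n : ℕ) : C₀(ℕ, ℝ) where
  toFun := Pi.single n 1
  continuous_toFun := continuous_of_discreteTopology
  zero_at_infty' := by
    rw [cocompact_eq_cofinite]
    refine tendsto_const_nhds.congr' ?_
    filter_upwards [(finite_singleton n).compl_mem_cofinite] with m hm
    exact (Pi.single_eq_of_ne (M := fun _ => ℝ) (by simpa using hm) _).symm

@[simp]
theorem unitVec_apply (n m : ℕ) : unitVec n m = (Pi.single n (1 : ℝ) : ℕ → ℝ) m := rfl

/-- Any finite set containing the finitely many indices with `|x n| ≥ ε / 2` leaves a remainder of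
sup norm at most `ε / 2`, whatever the order of summation. -/
theorem hasSum_unitVec (x : C₀(ℕ, ℝ)) : HasSum (fun n => x n • unitVec n) x := by
  rw [HasSum, SummationFilter.unconditional_filter, Metric.tendsto_atTop]
  intro ε hε
  refine ⟨(finite_le_abs x (half_pos hε)).toFinset, fun A hA => ?_⟩
  rw [dist_eq_norm]
  refine (norm_le (half_pos hε).le fun m => ?_).trans_lt (half_lt_self hε)
  have hval : (∑ n ∈ A, x n • unitVec n - x) m = if m ∈ A then 0 else -x m := by
    have : (∑ n ∈ A, x n • unitVec n) m = ∑ n ∈ A, x n * (Pi.single n (1 : ℝ) : ℕ → ℝ) m := by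
      rw [← coord_apply, map_sum]
      simp
    rw [ZeroAtInftyContinuousMap.sub_apply, this]
    simp only [Pi.single_apply, mul_ite, mul_one, mul_zero, Finset.sum_ite_eq]
    split_ifs <;> simp
  rw [hval]
  split_ifs with hm
  · simpa using (half_pos hε).le
  · have : ¬ ε / 2 ≤ |x m| := fun h => hm (hA (by simpa using h))
    rw [abs_neg]
    exact (not_le.1 this).le

/-- The unit vector basis of `c₀`. -/
noncomputable def unitVecBasis : UnconditionalSchauderBasis ℕ ℝ C₀(ℕ, ℝ) where
  basis := unitVec
  coord := coord
  ortho i j := by simp [Pi.single_apply]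
  expansion := hasSum_unitVec

theorem not_finiteDimensional : ¬ FiniteDimensional ℝ C₀(ℕ, ℝ) := fun _ =>
  not_finite_iff_infinite.2 (inferInstanceAs (Infinite ℕ))
    unitVecBasis.linearIndependent.finite

/-! ### A `C^1` norm on `c₀` depending locally on finitely many coordinates -/

/-- The sum of the unit balls of `c₀` and `ℓ²`, described coordinatewise. -/
def excessBall : Set C₀(ℕ, ℝ) := {x | ∀ A : Finset ℕ, ∑ n ∈ A, excessSq (x n) 1 ≤ 1}

/-- Quantifying over finite partial sums makes the set an intersection of closed conditions, each on
finitely many coordinates. -/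
theorem isClosed_excessBall : IsClosed excessBall := by
  rw [excessBall, ofPred_forall]
  refine isClosed_iInter fun A => isClosed_le ?_ continuous_const
  refine continuous_finsetSum _ fun n _ => ?_
  exact contDiff_excessSq.continuous.comp ((coord n).continuous.prodMk continuous_const)

theorem convex_excessBall : Convex ℝ excessBall := by
  intro x hx y hy t u ht hu htu A
  calc ∑ n ∈ A, excessSq ((t • x + u • y) n) 1
      ≤ ∑ n ∈ A, (t * excessSq (x n) 1 + u * excessSq (y n) 1) :=
        Finset.sum_le_sum fun n _ => (convexOn_excessSq 1).2 trivial trivial ht hu htu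
    _ = t * ∑ n ∈ A, excessSq (x n) 1 + u * ∑ n ∈ A, excessSq (y n) 1 := by
        rw [Finset.sum_add_distrib, Finset.mul_sum, Finset.mul_sum]
    _ ≤ t * 1 + u * 1 := by gcongr; exacts [hx A, hy A]
    _ = 1 := by rw [← add_mul, htu, one_mul]

theorem balanced_excessBall : Balanced ℝ excessBall := by
  refine balanced_iff_smul_mem.2 fun c hc x hx A => ?_
  refine (Finset.sum_le_sum fun n _ => ?_).trans (hx A)
  rw [excessSq_eq_posSq_abs _ zero_le_one, excessSq_eq_posSq_abs _ zero_le_one]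
  refine posSq_mono (sub_le_sub_right ?_ 1)
  rw [ZeroAtInftyContinuousMap.smul_apply, smul_eq_mul, abs_mul]
  exact mul_le_of_le_one_left (abs_nonneg _) hc

theorem closedBall_subset_excessBall : Metric.closedBall 0 1 ⊆ excessBall := by
  intro x hx A
  rw [Finset.sum_eq_zero fun n _ => excessSq_eq_zero
    ((abs_apply_le_norm x n).trans (by simpa using hx))]
  exact zero_le_one

theorem excessBall_subset_closedBall : excessBall ⊆ Metric.closedBall 0 2 := by
  intro x hx
  rw [mem_closedBall_zero_iff]
  refine norm_le zero_le_two fun n => ?_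
  have h := hx {n}
  rw [Finset.sum_singleton, excessSq_eq_posSq_abs _ zero_le_one, posSq,
    sq_le_one_iff₀ (le_max_right _ _)] at h
  linarith [(le_max_left _ _).trans h]

theorem excessBall_mem_nhds : excessBall ∈ 𝓝 (0 : C₀(ℕ, ℝ)) :=
  mem_of_superset (Metric.closedBall_mem_nhds 0 one_pos) closedBall_subset_excessBall

/-- An equivalent `C^1` norm on `c₀` that locally depends on finitely many coordinates. -/
noncomputable def excessNorm : Seminorm ℝ C₀(ℕ, ℝ) :=
  gaugeSeminorm balanced_excessBall convex_excessBall (absorbent_nhds_zero excessBall_mem_nhds)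

theorem excessNorm_le_norm (x : C₀(ℕ, ℝ)) : excessNorm x ≤ ‖x‖ := by
  have h := mul_gauge_le_norm (x := x)
    (Metric.ball_subset_closedBall.trans closedBall_subset_excessBall)
  rwa [one_mul] at h

theorem norm_le_excessNorm (x : C₀(ℕ, ℝ)) : ‖x‖ / 2 ≤ excessNorm x :=
  le_gauge_of_subset_closedBall (absorbent_nhds_zero excessBall_mem_nhds) zero_le_two
    excessBall_subset_closedBall

/-- As the ball is closed, its gauge is at most 1 exactly on it; rescaling by `s` uses that
`excessSq` is jointly homogeneous of degree 2. -/
theorem excessNorm_le_iff (x : C₀(ℕ, ℝ)) {s : ℝ} (hs : 0 < s) :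
    excessNorm x ≤ s ↔ ∀ A : Finset ℕ, ∑ n ∈ A, excessSq (x n) s ≤ s ^ 2 := by
  have h1 : excessNorm x ≤ s ↔ excessNorm (s⁻¹ • x) ≤ 1 := by
    rw [map_smul_eq_mul, Real.norm_of_nonneg (inv_nonneg.2 hs.le), inv_mul_le_iff₀ hs, mul_one]
  have h2 : excessNorm (s⁻¹ • x) ≤ 1 ↔ s⁻¹ • x ∈ excessBall := by
    rw [← isClosed_excessBall.closure_eq]
    exact gauge_le_one_iff_mem_closure convex_excessBall excessBall_mem_nhds
  rw [h1, h2]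
  refine forall_congr' fun A => ?_
  have h3 : ∀ n, excessSq ((s⁻¹ • x) n) 1 = (s ^ 2)⁻¹ * excessSq (x n) s := fun n => by
    rw [← inv_pow, ← excessSq_mul (inv_nonneg.2 hs.le), inv_mul_cancel₀ hs.ne']
    rfl
  simp only [h3]
  rw [← Finset.mul_sum, inv_mul_le_iff₀ (by positivity), mul_one]

/-- Near a nonzero point, `excessNorm` is given by an implicit equation involving only finitely
many coordinates. -/
theorem exists_excessNorm_eq_iff {x : C₀(ℕ, ℝ)} (hx : x ≠ 0) :
    ∃ (m : ℕ) (r : ℝ) (V : Set C₀(ℕ, ℝ)), 0 < r ∧ IsOpen V ∧ x ∈ V ∧ ∀ y ∈ V, r < excessNorm y ∧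
      ∀ s, r < s → (∑ n ∈ Finset.range m, excessSq (y n) s - s ^ 2 = 0 ↔ excessNorm y = s) := by
  have hx0 : 0 < ‖x‖ := norm_pos_iff.2 hx
  obtain ⟨m, hm⟩ := (finite_le_abs x (by positivity : 0 < ‖x‖ / 8)).bddAbove
  -- For `y` within `‖x‖ / 8` of `x`, coordinates beyond `m` are below `‖x‖ / 8 + ‖x‖ / 8 = r`, so
  -- they have no excess over any `s > r`. Also `excessNorm y ≥ ‖y‖ / 2 ≥ 7 ‖x‖ / 16 > r`.
  refine ⟨m + 1, ‖x‖ / 4, Metric.ball x (‖x‖ / 8), by positivity, Metric.isOpen_ball,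
    Metric.mem_ball_self (by positivity), fun y hy => ?_⟩
  rw [mem_ball_iff_norm] at hy
  have hr : ‖x‖ / 4 < excessNorm y := by
    have h1 := norm_le_excessNorm y
    have h2 := norm_sub_norm_le x y
    rw [norm_sub_rev] at h2
    linarith
  have htail : ∀ n, n ∉ Finset.range (m + 1) → |y n| ≤ ‖x‖ / 4 := by
    intro n hn
    have h1 : |x n| < ‖x‖ / 8 := by
      by_contra! h
      exact hn (Finset.mem_range.2 (Nat.lt_succ_of_le (hm h)))
    have h2 := abs_apply_le_norm (y - x) n
    have h3 := abs_sub_abs_le_abs_sub (y n) (x n)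
    rw [ZeroAtInftyContinuousMap.sub_apply] at h2
    linarith
  have hiff : ∀ s, ‖x‖ / 4 < s →
      (excessNorm y ≤ s ↔ ∑ n ∈ Finset.range (m + 1), excessSq (y n) s - s ^ 2 ≤ 0) := by
    intro s hs
    rw [excessNorm_le_iff y (by linarith), sub_nonpos]
    refine ⟨fun h => h _, fun h A => le_trans ?_ h⟩
    calc ∑ n ∈ A, excessSq (y n) s ≤ ∑ n ∈ Finset.range (m + 1) ∪ A, excessSq (y n) s :=
          Finset.sum_le_sum_of_subset_of_nonneg Finset.subset_union_right
            fun n _ _ => excessSq_nonneg _ _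
      _ = ∑ n ∈ Finset.range (m + 1), excessSq (y n) s :=
          (Finset.sum_subset Finset.subset_union_left fun n _ hn =>
            excessSq_eq_zero ((htail n hn).trans hs.le)).symm
  have hanti : ∀ s t, ‖x‖ / 4 < s → s < t →
      ∑ n ∈ Finset.range (m + 1), excessSq (y n) t - t ^ 2 <
        ∑ n ∈ Finset.range (m + 1), excessSq (y n) s - s ^ 2 := by
    intro s t hs hst
    rw [sub_eq_add_neg, sub_eq_add_neg]
    exact add_lt_add_of_le_of_lt (Finset.sum_le_sum fun n _ => excessSq_antitone _ hst.le)
      (neg_lt_neg (pow_lt_pow_left₀ hst (by linarith) two_ne_zero))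
  have hcont : Continuous fun s => ∑ n ∈ Finset.range (m + 1), excessSq (y n) s - s ^ 2 :=
    (continuous_finsetSum _ fun n _ => contDiff_excessSq.continuous.comp
      (continuous_const.prodMk continuous_id)).sub (continuous_pow 2)
  have hroot :
      ∑ n ∈ Finset.range (m + 1), excessSq (y n) (excessNorm y) - excessNorm y ^ 2 = 0 := by
    -- A negative value at `excessNorm y` would stay negative at some slightly smaller `s > r`, and
    -- `hiff` would give `excessNorm y ≤ s`.
    refine le_antisymm ((hiff _ hr).1 le_rfl) (not_lt.1 fun hlt => ?_)
    have hev := hcont.continuousAt.eventually_lt (continuousAt_const (y := (0 : ℝ))) hlt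
    obtain ⟨s, ⟨hs0, hsr⟩, hsN⟩ := ((((hev.and (lt_mem_nhds hr)).filter_mono
      nhdsWithin_le_nhds).and self_mem_nhdsWithin) :
        ∀ᶠ s in 𝓝[<] (excessNorm y), _).exists
    exact absurd ((hiff s hsr).2 hs0.le) (not_le.2 hsN)
  refine ⟨hr, fun s hs => ⟨fun h0 => ?_, fun h => h ▸ hroot⟩⟩
  refine le_antisymm ((hiff s hs).2 h0.le) (not_lt.1 fun hlt => ?_)
  have := hanti _ _ hr hlt
  rw [h0, hroot] at this
  exact lt_irrefl 0 this

theorem isEquivalentNorm_excessNorm : IsEquivalentNorm excessNorm :=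
  ⟨1 / 2, 1, by norm_num, one_pos, fun x =>
    ⟨by linarith [norm_le_excessNorm x], by linarith [excessNorm_le_norm x]⟩⟩

theorem locallyDependsOnFinitelyManyCoordinates_excessNorm :
    LocallyDependsOnFinitelyManyCoordinates excessNorm := by
  intro x hx
  obtain ⟨m, r, V, -, hV, hxV, h⟩ := exists_excessNorm_eq_iff hx
  refine ⟨m, V, fun i => coord i,
    -- The infimum merely selects the root: for `y ∈ V` the set is a singleton, while `γ` must be
    -- defined on all of `ℝ^m`.
    fun z => sInf {s | r < s ∧ ∑ i, excessSq (z i) s - s ^ 2 = 0}, hV, hxV, fun y hy => ?_⟩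
  suffices hset : {s | r < s ∧ ∑ i : Fin m, excessSq (coord i y) s - s ^ 2 = 0} =
      {excessNorm y} by
    beta_reduce
    rw [hset, csInf_singleton]
  ext s
  simp only [coord_apply, mem_ofPred_eq, mem_singleton_iff]
  rw [Fin.sum_univ_eq_sum_range fun n => excessSq (y n) s]
  constructor
  · rintro ⟨hs, h0⟩
    exact (((h y hy).2 s hs).1 h0).symm
  · rintro rfl
    exact ⟨(h y hy).1, ((h y hy).2 _ (h y hy).1).2 rfl⟩

/-- The implicit function theorem applies to the local equation: its `s`-derivative is a sum of
nonpositive terms minus `2 * t` with `t > 0`, hence nonzero. -/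
theorem isC1Norm_excessNorm : IsC1Norm excessNorm := by
  intro x hx
  refine ContDiffAt.contDiffWithinAt ?_
  obtain ⟨m, r, V, hr, hV, hxV, h⟩ := exists_excessNorm_eq_iff hx
  let G : C₀(ℕ, ℝ) × ℝ → ℝ := fun p =>
    ∑ n ∈ Finset.range m, excessSq (p.1 n) p.2 - p.2 ^ 2
  have hG : ContDiff ℝ 1 G := by
    refine (ContDiff.sum fun n _ => ?_).sub (contDiff_snd.pow 2)
    exact contDiff_excessSq.comp (((coord n).contDiff.comp contDiff_fst).prodMk contDiff_snd)
  set t := excessNorm x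
  obtain ⟨hrt, hxt⟩ := h x hxV
  have hGt : G (x, t) = 0 := (hxt t hrt).2 rfl
  have hderiv : HasDerivAt (fun s => G (x, s)) (∑ n ∈ Finset.range m,
      (2 * max (x n - t) 0 * -1 + 2 * max (-x n - t) 0 * -1) - 2 * t) t := by
    refine HasDerivAt.sub (HasDerivAt.fun_sum fun n _ => HasDerivAt.add ?_ ?_) ?_
    · exact (hasDerivAt_posSq _).comp t ((hasDerivAt_id t).const_sub (x n))
    · exact (hasDerivAt_posSq _).comp t ((hasDerivAt_id t).const_sub (-x n))
    · simpa using hasDerivAt_pow 2 t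
  have hneg : ∑ n ∈ Finset.range m,
      (2 * max (x n - t) 0 * -1 + 2 * max (-x n - t) 0 * -1) - 2 * t < 0 := by
    have : ∑ n ∈ Finset.range m,
        (2 * max (x n - t) 0 * -1 + 2 * max (-x n - t) 0 * -1) ≤ 0 :=
      Finset.sum_nonpos fun n _ => by
        linarith [le_max_right (x n - t) 0, le_max_right (-x n - t) 0]
    linarith
  have hcd : ContDiffAt ℝ 1 G (x, t) := hG.contDiffAt
  have hinv : (fderiv ℝ G (x, t) ∘L .inr ℝ C₀(ℕ, ℝ) ℝ).IsInvertible := by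
    refine ⟨ContinuousLinearEquiv.unitsEquivAut ℝ (Units.mk0 _ hneg.ne), ?_⟩
    have hpair : HasDerivAt (fun s : ℝ => (x, s)) (0, 1) t :=
      (hasDerivAt_const t x).prodMk (hasDerivAt_id t)
    have := hderiv.unique
      ((hcd.differentiableAt one_ne_zero).hasFDerivAt.comp_hasDerivAt t hpair)
    ext
    simpa using this
  have hφ := hcd.contDiffAt_implicitFunction one_ne_zero hinv
  have hφ0 := hcd.implicitFunction_apply_self one_ne_zero hinv
  have hφG := hcd.eventually_apply_implicitFunction one_ne_zero hinv
  refine hφ.congr_of_eventuallyEq ?_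
  -- The root is characterised only among `s > r`, so the implicit function must be kept above `r`
  -- before it can be identified with the norm.
  have hφr : ∀ᶠ y in 𝓝 x, r < hcd.implicitFunction one_ne_zero hinv y :=
    continuousAt_const.eventually_lt hφ.continuousAt (by rw [hφ0]; exact hrt)
  filter_upwards [hφr, hφG, hV.mem_nhds hxV] with y hy1 hy2 hy3
  exact ((h y hy3).2 _ hy1).1 (hy2.trans hGt)

theorem hasC1FiniteCoordinateNorm : HasC1FiniteCoordinateNorm C₀(ℕ, ℝ) where
  infinite_dimensional := not_finiteDimensional
  unconditional_basis := ⟨unitVecBasis⟩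
  exists_norm := ⟨excessNorm, isEquivalentNorm_excessNorm, isC1Norm_excessNorm,
    locallyDependsOnFinitelyManyCoordinates_excessNorm⟩

end NullSequence

/-! ### The main theorem -/

theorem mainTheorem7 :
    (∀ (E : Type*) [NormedAddCommGroup E] [NormedSpace ℝ E] [CompleteSpace E],
      HasC1FiniteCoordinateNorm E →
      ∀ U : Set E, IsOpen U →
        ∃ lam : E → ℝ, ContDiff ℝ 1 lam ∧ (∀ x, 0 ≤ lam x) ∧ tsupport lam = closure U ∧
          ∀ x ∈ U, Function.Surjective (fderiv ℝ lam x)) ∧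
    (HasC1FiniteCoordinateNorm C₀(ℕ, ℝ) ∧
      ∀ U : Set C₀(ℕ, ℝ), IsOpen U →
        ∃ lam : C₀(ℕ, ℝ) → ℝ, ContDiff ℝ 1 lam ∧ (∀ x, 0 ≤ lam x) ∧ tsupport lam = closure U ∧
          ∀ x ∈ U, Function.Surjective (fderiv ℝ lam x)) :=
  ⟨fun _ _ _ _ h _ hU => h.exists_contDiff_tsupport_eq hU,
    NullSequence.hasC1FiniteCoordinateNorm,
    fun _ hU => NullSequence.hasC1FiniteCoordinateNorm.exists_contDiff_tsupport_eq hU⟩
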